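/- For an integer $n\ge 0$ let $$R_n=\sup\Big\{r\in(0,1):\ \sum_{k=0}^n|a_k|r^k\le\sup_{|z|<1}|p(z)|\ \text{ for all polynomials } p(z)=\sum_{k=0}^n a_kz^k \text{ with complex coefficients}\Big\}$$ be the Bohr radius for complex polynomials of degree at most $n$. Then $$\lim_{n\to\infty}n^2\Big(R_n-\frac13\Big)=\frac{\pi^2}{3},$$ that is, $R_n=\frac13+\frac{\pi^2}{3n^2}+o\big(\frac1{n^2}\big)$ as $n\to\infty$. -/

import Mathlib

open Filter Topology Asymptotics

/-- The supremum norm `‖p‖_∞ = sup_{|z| < 1} |p(z)|` of a complex polynomial on the open unit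
disk. -/
noncomputable def supNorm (p : Polynomial ℂ) : ℝ :=
  ⨆ z : Metric.ball (0 : ℂ) 1, ‖p.eval (z : ℂ)‖

/-- The supremum defining `supNorm` is over a bounded set, so it is a genuine supremum. -/
theorem bddAbove_supNorm (p : Polynomial ℂ) :
    BddAbove (Set.range fun z : Metric.ball (0 : ℂ) 1 => ‖p.eval (z : ℂ)‖) := by
  obtain ⟨C, hC⟩ := (isCompact_closedBall (0 : ℂ) 1).exists_bound_of_continuousOn
    (f := fun z => p.eval z) p.continuous.continuousOn
  refine ⟨C, ?_⟩
  rintro _ ⟨z, rfl⟩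
  exact hC z (Metric.ball_subset_closedBall z.2)

/-- The Bohr radius `R_n` for complex polynomials of degree at most `n`: the supremum of all
`r ∈ (0, 1)` such that `∑_{k=0}^n |a_k| r^k ≤ ‖p‖_∞` for every polynomial
`p(z) = ∑_{k=0}^n a_k z^k` with complex coefficients. -/
noncomputable def bohrRadius (n : ℕ) : ℝ :=
  sSup {r : ℝ | r ∈ Set.Ioo (0 : ℝ) 1 ∧
    ∀ p : Polynomial ℂ, p.natDegree ≤ n →
      ∑ k ∈ Finset.range (n + 1), ‖p.coeff k‖ * r ^ k ≤ supNorm p}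

/-! The Bohr inequality at radius `r` in degree `n` is equivalent to the matrix inequality `K ≤ 2 I`
for `K = (r ^ |i - j|)`, `0 ≤ i, j ≤ n`.

If `K ≤ 2 I`, rotate so that `a_0 ≥ 0` and take `M > ‖p‖`. By Fejér–Riesz, `M - Re p = |H|²` on the
circle. Comparing coefficients gives `M - a_0 = ∑ |h_i|²`, while the other `a_k` are minus those of
the autocorrelation of `h`. The form of `K` at `|h_i|` then bounds `∑_{k ≥ 1} |a_k| r^k` by `M -
a_0` (`bohr_inequality_of_kms_form_le`). If `K ≤ 2 I` fails at a vector `x`, a small perturbation `1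
- ε q`, with `q` the autocorrelation of `x`, violates the inequality
(`exists_supNorm_lt_of_lt_kms_form`).

Up to boundary terms, `K` acts on sine vectors of frequency `θ` as the scalar `(1 - r²) / (1 - 2 r
cos θ + r²)`, which is at most `2` iff `3 r² - 4 r cos θ + 1 ≥ 0`. The signs of the boundary terms
give an upper bound for `K` with `θ = π / (n + 4)` and a lower one with `θ = π / (n + 2)`. At `r =
1/3 + a / n²` the quadratic is asymptotic to `2 (π²/3 - a) / n²` for both angles when `a ≠ π²/3`,
which pins down the limit. -/

/-! ### The Kac–Murdock–Szegő kernel -/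

/-- The entry `r ^ |i - j|` of the Kac–Murdock–Szegő matrix. -/
def kms (r : ℝ) (i j : ℕ) : ℝ := r ^ ((i - j) + (j - i))

theorem kms_comm (r : ℝ) (i j : ℕ) : kms r i j = kms r j i := by
  rw [kms, kms, add_comm]

theorem kms_nonneg {r : ℝ} (hr : 0 ≤ r) (i j : ℕ) : 0 ≤ kms r i j := pow_nonneg hr _

theorem kms_sum_diag {r c : ℝ} {w : ℕ → ℝ} (hw : ∀ j, w (j + 2) + w j = 2 * c * w (j + 1))
    (i : ℕ) :
    (1 - 2 * r * c + r ^ 2) * ∑ j ∈ Finset.range (i + 1), r ^ (i - j) * w (j + 1) =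
      w (i + 1) - r * w (i + 2) - r ^ (i + 1) * (w 0 - r * w 1) := by
  induction i with
  | zero =>
    have := hw 0
    simp at this ⊢
    linear_combination r * this
  | succ i ih =>
    have h1 : ∑ j ∈ Finset.range (i + 1), r ^ (i + 1 - j) * w (j + 1) =
        r * ∑ j ∈ Finset.range (i + 1), r ^ (i - j) * w (j + 1) := by
      rw [Finset.mul_sum]
      refine Finset.sum_congr rfl fun j hj => ?_
      rw [Nat.succ_sub (Finset.mem_range_succ_iff.1 hj), pow_succ]
      ring
    rw [Finset.sum_range_succ, h1]
    have := hw (i + 1)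
    simp only [Nat.sub_self, pow_zero, one_mul]
    rw [pow_succ r (i + 1)]
    linear_combination r * ih + r * this

/-- The kernel inverts a second-difference operator away from the ends, so solutions of the
recurrence are eigenvectors up to one boundary term per end. The ghost values `w 0` and `w (n + 2)`
enter only there. -/
theorem kms_row_sum {r c : ℝ} {w : ℕ → ℝ} (hw : ∀ j, w (j + 2) + w j = 2 * c * w (j + 1))
    {n i : ℕ} (hi : i ≤ n) :
    (1 - 2 * r * c + r ^ 2) * ∑ j ∈ Finset.range (n + 1), kms r i j * w (j + 1) =
      (1 - r ^ 2) * w (i + 1) - r ^ (i + 1) * (w 0 - r * w 1)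
        - r ^ (n - i + 1) * (w (n + 2) - r * w (n + 1)) := by
  induction n, hi using Nat.le_induction with
  | base =>
    have h1 : ∑ j ∈ Finset.range (i + 1), kms r i j * w (j + 1) =
        ∑ j ∈ Finset.range (i + 1), r ^ (i - j) * w (j + 1) := by
      refine Finset.sum_congr rfl fun j hj => ?_
      rw [kms, Nat.sub_eq_zero_of_le (Finset.mem_range_succ_iff.1 hj), add_zero]
    rw [h1, kms_sum_diag hw]
    simp
    ring
  | succ n hn ih =>
    rw [Finset.sum_range_succ, mul_add, ih, kms, Nat.sub_eq_zero_of_le (by omega : i ≤ n + 1),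
      zero_add, Nat.succ_sub hn, Nat.succ_eq_add_one, pow_succ r (n - i + 1)]
    linear_combination r * r ^ (n - i + 1) * hw (n + 1)

theorem sin_recurrence (θ a : ℝ) :
    ∀ j : ℕ, Real.sin (((j + 2 : ℕ) + a) * θ) + Real.sin ((j + a) * θ) =
      2 * Real.cos θ * Real.sin (((j + 1 : ℕ) + a) * θ) := by
  intro j
  have h1 : ((j + 2 : ℕ) + a) * θ = ((j + 1 : ℕ) + a) * θ + θ := by push_cast; ring
  have h2 : (j + a) * θ = ((j + 1 : ℕ) + a) * θ - θ := by push_cast; ring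
  rw [h1, h2, Real.sin_add, Real.sin_sub]
  ring

theorem one_sub_two_mul_cos_add_sq_pos {r : ℝ} (hr0 : 0 < r) (hr1 : r < 1) (θ : ℝ) :
    0 < 1 - 2 * r * Real.cos θ + r ^ 2 := by
  nlinarith [Real.cos_le_one θ, mul_pos hr0 hr0, sq_pos_of_pos (sub_pos.2 hr1)]

/-- Schur test for symmetric nonnegative kernels. -/
theorem schur_test {ι : Type*} (s : Finset ι) (K : ι → ι → ℝ) (hK : ∀ i j, K i j = K j i)
    (hK0 : ∀ i j, 0 ≤ K i j) (v : ι → ℝ) (hv : ∀ i ∈ s, 0 < v i) (C : ℝ)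
    (h : ∀ i ∈ s, ∑ j ∈ s, K i j * v j ≤ C * v i) (x : ι → ℝ) :
    ∑ i ∈ s, ∑ j ∈ s, K i j * (x i * x j) ≤ C * ∑ i ∈ s, x i ^ 2 := by
  have key : ∀ i ∈ s, ∀ j ∈ s, K i j * (x i * x j) ≤
      (K i j * v j * (x i ^ 2 / v i) + K j i * v i * (x j ^ 2 / v j)) / 2 := by
    intro i hi j hj
    have hi' := hv i hi
    have hj' := hv j hj
    rw [hK j i]
    have : x i * x j ≤ (v j * (x i ^ 2 / v i) + v i * (x j ^ 2 / v j)) / 2 := by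
      have : (v j * (x i ^ 2 / v i) + v i * (x j ^ 2 / v j)) / 2 - x i * x j =
          (v j * x i - v i * x j) ^ 2 / (2 * v i * v j) := by
        field_simp
        ring
      have h0 : 0 ≤ (v j * x i - v i * x j) ^ 2 / (2 * v i * v j) := by positivity
      linarith
    calc _ ≤ K i j * ((v j * (x i ^ 2 / v i) + v i * (x j ^ 2 / v j)) / 2) :=
          mul_le_mul_of_nonneg_left this (hK0 i j)
      _ = _ := by ring
  have hsum : ∑ i ∈ s, ∑ j ∈ s, K i j * v j * (x i ^ 2 / v i) ≤ C * ∑ i ∈ s, x i ^ 2 := by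
    rw [Finset.mul_sum]
    refine Finset.sum_le_sum fun i hi => ?_
    have hi' := hv i hi
    rw [← Finset.sum_mul]
    calc _ ≤ C * v i * (x i ^ 2 / v i) :=
          mul_le_mul_of_nonneg_right (h i hi) (by positivity)
      _ = _ := by field_simp
  calc _ ≤ ∑ i ∈ s, ∑ j ∈ s,
        (K i j * v j * (x i ^ 2 / v i) + K j i * v i * (x j ^ 2 / v j)) / 2 :=
        Finset.sum_le_sum fun i hi => Finset.sum_le_sum fun j hj => key i hi j hj
    _ = (∑ i ∈ s, ∑ j ∈ s, K i j * v j * (x i ^ 2 / v i) +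
        ∑ i ∈ s, ∑ j ∈ s, K j i * v i * (x j ^ 2 / v j)) / 2 := by
        rw [← Finset.sum_add_distrib, Finset.sum_div]
        refine Finset.sum_congr rfl fun i _ => ?_
        rw [← Finset.sum_add_distrib, Finset.sum_div]
    _ = ∑ i ∈ s, ∑ j ∈ s, K i j * v j * (x i ^ 2 / v i) := by
        rw [Finset.sum_comm (f := fun i j => K j i * v i * (x j ^ 2 / v j))]
        ring
    _ ≤ _ := hsum

/-- Schur test with a sine vector whose zeros lie one step beyond the ghost indices. The boundary
terms then only decrease the row sums, because `sin θ - r sin 2θ = sin θ (1 - 2 r cos θ) ≥ 0` for `r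
≤ 1 / 2`. -/
theorem kms_form_le {n : ℕ} {r : ℝ} (hr0 : 0 < r) (hr1 : r ≤ 1 / 2)
    (h : 0 ≤ 3 * r ^ 2 - 4 * r * Real.cos (Real.pi / (n + 4)) + 1) (x : ℕ → ℝ) :
    ∑ i ∈ Finset.range (n + 1), ∑ j ∈ Finset.range (n + 1), kms r i j * (x i * x j) ≤
      2 * ∑ i ∈ Finset.range (n + 1), x i ^ 2 := by
  set θ : ℝ := Real.pi / (n + 4) with hθ
  have hn : (0 : ℝ) < n + 4 := by positivity
  have hθn : (n + 4 : ℝ) * θ = Real.pi := by rw [hθ]; field_simp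
  have hθ0 : 0 < θ := by positivity
  have hpos : ∀ a : ℝ, 0 < a → a < n + 4 → 0 < Real.sin (a * θ) := fun a ha ha' =>
    Real.sin_pos_of_pos_of_lt_pi (by positivity) (by rw [← hθn]; gcongr)
  have hD := one_sub_two_mul_cos_add_sq_pos hr0 (by linarith) θ
  have hsin : 0 ≤ Real.sin θ - r * Real.sin (2 * θ) := by
    have h1 : 0 < Real.sin θ := by simpa using hpos 1 one_pos (by linarith)
    rw [Real.sin_two_mul]
    have : r * Real.cos θ ≤ 1 / 2 := by nlinarith [Real.cos_le_one θ]
    nlinarith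
  refine schur_test (Finset.range (n + 1)) (kms r) (kms_comm r) (kms_nonneg hr0.le)
    (fun j => Real.sin (((j + 1 : ℕ) + 1) * θ)) (fun i hi => ?_) 2 (fun i hi => ?_) x
  · have hi' : (i : ℝ) ≤ n := by exact_mod_cast Finset.mem_range_succ_iff.1 hi
    exact hpos _ (by positivity) (by push_cast; linarith)
  · have hi' : i ≤ n := Finset.mem_range_succ_iff.1 hi
    have hi'' : (i : ℝ) ≤ n := by exact_mod_cast hi'
    have hrow := kms_row_sum (r := r) (w := fun j => Real.sin ((j + 1) * θ)) (sin_recurrence θ 1) hi'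
    have e1 : Real.sin (((n + 2 : ℕ) + 1) * θ) = Real.sin θ := by
      rw [← Real.sin_pi_sub, ← hθn]; push_cast; ring_nf
    have e2 : Real.sin (((n + 1 : ℕ) + 1) * θ) = Real.sin (2 * θ) := by
      rw [← Real.sin_pi_sub, ← hθn]; push_cast; ring_nf
    have e3 : Real.sin (((0 : ℕ) + 1) * θ) = Real.sin θ := by norm_num
    have e4 : Real.sin (((1 : ℕ) + 1) * θ) = Real.sin (2 * θ) := by norm_num
    simp only [e1, e2, e3, e4] at hrow
    have hvi : 0 < Real.sin (((i + 1 : ℕ) + 1) * θ) :=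
      hpos _ (by positivity) (by push_cast; linarith)
    refine le_of_mul_le_mul_left ?_ hD
    rw [hrow]
    have q1 : 0 ≤ r ^ (i + 1) * (Real.sin θ - r * Real.sin (2 * θ)) := by positivity
    have q2 : 0 ≤ r ^ (n - i + 1) * (Real.sin θ - r * Real.sin (2 * θ)) := by positivity
    -- The quadratic in `h` is `2 (1 - 2 r cos θ + r²) - (1 - r²)`.
    nlinarith [mul_nonneg h hvi.le]

/-- Here the sine vanishes exactly at the ghost indices, so both boundary terms increase the row
sums and every row exceeds twice the entry. -/
theorem lt_kms_form_sin {n : ℕ} {r : ℝ} (hr0 : 0 < r) (hr1 : r < 1)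
    (h : 3 * r ^ 2 - 4 * r * Real.cos (Real.pi / (n + 2)) + 1 < 0) :
    ∃ x : ℕ → ℝ,
    2 * ∑ i ∈ Finset.range (n + 1), x i ^ 2 <
      ∑ i ∈ Finset.range (n + 1), ∑ j ∈ Finset.range (n + 1), kms r i j * (x i * x j) := by
  set θ : ℝ := Real.pi / (n + 2) with hθ
  have hn : (0 : ℝ) < n + 2 := by positivity
  have hθn : (n + 2 : ℝ) * θ = Real.pi := by rw [hθ]; field_simp
  have hθ0 : 0 < θ := by positivity
  have hpos : ∀ a : ℝ, 0 < a → a < n + 2 → 0 < Real.sin (a * θ) := fun a ha ha' =>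
    Real.sin_pos_of_pos_of_lt_pi (by positivity) (by rw [← hθn]; gcongr)
  have hD := one_sub_two_mul_cos_add_sq_pos hr0 hr1 θ
  have hsin : 0 < Real.sin θ := by simpa using hpos 1 one_pos (by linarith)
  have hxpos : ∀ i ∈ Finset.range (n + 1), 0 < Real.sin (((i + 1 : ℕ) + 0) * θ) := by
    intro i hi
    have hi' : (i : ℝ) ≤ n := by exact_mod_cast Finset.mem_range_succ_iff.1 hi
    exact hpos _ (by positivity) (by push_cast; linarith)
  refine ⟨fun j => Real.sin (((j + 1 : ℕ) + 0) * θ), ?_⟩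
  rw [Finset.mul_sum]
  refine Finset.sum_lt_sum_of_nonempty (by simp) fun i hi => ?_
  have hi' : i ≤ n := Finset.mem_range_succ_iff.1 hi
  have hrow := kms_row_sum (r := r) (w := fun j => Real.sin ((j + 0) * θ)) (sin_recurrence θ 0) hi'
  have e1 : Real.sin (((n + 2 : ℕ) + 0) * θ) = 0 := by
    have : ((n + 2 : ℕ) + 0) * θ = Real.pi := by rw [← hθn]; push_cast; ring
    rw [this, Real.sin_pi]
  have e2 : Real.sin (((n + 1 : ℕ) + 0) * θ) = Real.sin θ := by
    rw [← Real.sin_pi_sub, ← hθn]; push_cast; ring_nf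
  have e3 : Real.sin (((0 : ℕ) + 0) * θ) = 0 := by norm_num
  have e4 : Real.sin (((1 : ℕ) + 0) * θ) = Real.sin θ := by norm_num
  simp only [e1, e2, e3, e4] at hrow
  have hvi := hxpos i hi
  have hlt : 2 * Real.sin (((i + 1 : ℕ) + 0) * θ) <
      ∑ j ∈ Finset.range (n + 1), kms r i j * Real.sin (((j + 1 : ℕ) + 0) * θ) := by
    refine lt_of_mul_lt_mul_left ?_ hD.le
    rw [hrow]
    have q1 : 0 ≤ r ^ (i + 1) * (r * Real.sin θ) := by positivity
    have q2 : 0 ≤ r ^ (n - i + 1) * (r * Real.sin θ) := by positivity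
    nlinarith [mul_pos_of_neg_of_neg h (neg_neg_of_pos hvi)]
  calc _ = Real.sin (((i + 1 : ℕ) + 0) * θ) * (2 * Real.sin (((i + 1 : ℕ) + 0) * θ)) := by ring
    _ < Real.sin (((i + 1 : ℕ) + 0) * θ) *
        ∑ j ∈ Finset.range (n + 1), kms r i j * Real.sin (((j + 1 : ℕ) + 0) * θ) :=
        mul_lt_mul_of_pos_left hlt hvi
    _ = _ := by
        rw [Finset.mul_sum]
        exact Finset.sum_congr rfl fun j _ => by ring

/-! ### Polynomials on the unit circle and the Fejér–Riesz theorem -/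

open Polynomial in
theorem Polynomial.eq_of_eval_eq_of_norm_eq_one {p q : ℂ[X]}
    (h : ∀ z : ℂ, ‖z‖ = 1 → p.eval z = q.eval z) : p = q := by
  refine Polynomial.eq_of_infinite_eval_eq p q (Set.Infinite.mono (s := Metric.sphere 0 1) ?_ ?_)
  · intro z hz
    exact h z (by simpa using hz)
  · have hc : IsPreconnected (Metric.sphere (0 : ℂ) 1) :=
      isPreconnected_sphere (by simp) 0 1
    refine hc.infinite_of_nontrivial ⟨1, by simp, -1, by simp, ?_⟩
    norm_num

/-- The conjugate-reciprocal polynomial `z ^ N * conj (p (1 / conj z))`. -/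
noncomputable def conjReflect (N : ℕ) (p : Polynomial ℂ) : Polynomial ℂ :=
  (p.map (starRingEnd ℂ)).reflect N

theorem coeff_conjReflect (N : ℕ) (p : Polynomial ℂ) (k : ℕ) :
    (conjReflect N p).coeff k = starRingEnd ℂ (p.coeff (Polynomial.revAt N k)) := by
  rw [conjReflect, Polynomial.coeff_reflect, Polynomial.coeff_map]

theorem natDegree_conjReflect_le {N : ℕ} {p : Polynomial ℂ} (hp : p.natDegree ≤ N) :
    (conjReflect N p).natDegree ≤ N := by
  refine Polynomial.natDegree_le_iff_coeff_eq_zero.2 fun k hk => ?_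
  rw [coeff_conjReflect, Polynomial.revAt_eq_self_of_lt hk,
    Polynomial.coeff_eq_zero_of_natDegree_lt (by omega), map_zero]

theorem eval_conjReflect {N : ℕ} {p : Polynomial ℂ} (hp : p.natDegree ≤ N) {z : ℂ} (hz : z ≠ 0) :
    (conjReflect N p).eval z = z ^ N * starRingEnd ℂ (p.eval (starRingEnd ℂ z)⁻¹) := by
  let _ : Invertible z⁻¹ := invertibleOfNonzero (inv_ne_zero hz)
  have h := Polynomial.eval₂_reflect_mul_pow (RingHom.id ℂ) z⁻¹ N (p.map (starRingEnd ℂ))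
    (Polynomial.natDegree_map_le.trans hp)
  rw [invOf_eq_inv, inv_inv, Polynomial.eval₂_id, Polynomial.eval₂_id] at h
  have h2 : (p.map (starRingEnd ℂ)).eval z⁻¹ =
      starRingEnd ℂ (p.eval (starRingEnd ℂ z)⁻¹) := by
    rw [← Polynomial.eval_map_apply, map_inv₀, Complex.conj_conj]
  rw [← h2, ← h, conjReflect, inv_pow]
  field_simp

theorem eval_conjReflect_of_norm_eq_one {N : ℕ} {p : Polynomial ℂ} (hp : p.natDegree ≤ N) {z : ℂ}
    (hz : ‖z‖ = 1) : (conjReflect N p).eval z = z ^ N * starRingEnd ℂ (p.eval z) := by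
  have hz0 : z ≠ 0 := by rintro rfl; simp at hz
  rw [eval_conjReflect hp hz0, ← map_inv₀, Complex.inv_eq_conj hz, Complex.conj_conj]

theorem mul_conj_eq_one_of_norm_eq_one {z : ℂ} (hz : ‖z‖ = 1) : z * starRingEnd ℂ z = 1 := by
  rw [Complex.mul_conj']; simp [hz]

theorem conjReflect_eq_self {n : ℕ} {P : Polynomial ℂ} (hP : P.natDegree ≤ 2 * n)
    (h : ∀ z : ℂ, ‖z‖ = 1 → ∃ t : ℝ, P.eval z = t * z ^ n) : conjReflect (2 * n) P = P := by
  refine Polynomial.eq_of_eval_eq_of_norm_eq_one fun z hz => ?_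
  obtain ⟨t, ht⟩ := h z hz
  rw [eval_conjReflect_of_norm_eq_one hP hz, ht, map_mul, Complex.conj_ofReal, map_pow, two_mul,
    pow_add]
  have := mul_conj_eq_one_of_norm_eq_one hz
  calc _ = t * z ^ n * (z * starRingEnd ℂ z) ^ n := by rw [mul_pow]; ring
    _ = _ := by rw [this]; ring

/-- A polynomial which is positive on the circle after division by `z ^ (n + 1)` has a factor
`(z - α) (1 - conj α * z)`. -/
theorem exists_factor_of_pos_on_circle {n : ℕ} {P : Polynomial ℂ}
    (hP : P.natDegree ≤ 2 * (n + 1))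
    (h : ∀ z : ℂ, ‖z‖ = 1 → ∃ t : ℝ, 0 < t ∧ P.eval z = t * z ^ (n + 1)) :
    ∃ (α : ℂ) (P₁ : Polynomial ℂ), ‖α‖ ≠ 1 ∧ P₁.natDegree ≤ 2 * n ∧
      P = (Polynomial.X - Polynomial.C α) *
        (1 - Polynomial.C (starRingEnd ℂ α) * Polynomial.X) * P₁ := by
  have hrefl := conjReflect_eq_self hP fun z hz => (h z hz).imp fun t ht => ht.2
  have hroot : ∀ z : ℂ, ‖z‖ = 1 → P.eval z ≠ 0 := by
    intro z hz h0
    obtain ⟨t, ht, htz⟩ := h z hz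
    have hz0 : z ≠ 0 := by rintro rfl; simp at hz
    rw [htz] at h0
    exact mul_ne_zero (by exact_mod_cast ht.ne') (pow_ne_zero _ hz0) h0
  have hP0 : P ≠ 0 := by
    rintro rfl
    exact hroot 1 (by simp) (by simp)
  -- Self-reciprocity pairs the extreme coefficients: it rules out a constant `P`, and a root at `0`
  -- lowers the degree at the top as well.
  have hcoeff : P.coeff (2 * (n + 1)) = starRingEnd ℂ (P.coeff 0) := by
    conv_lhs => rw [← hrefl]
    rw [coeff_conjReflect, Polynomial.revAt_le le_rfl, Nat.sub_self]
  have hdeg : P.degree ≠ 0 := by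
    intro hd
    have hnd := Polynomial.natDegree_eq_zero_iff_degree_le_zero.2 hd.le
    rw [Polynomial.coeff_eq_zero_of_natDegree_lt (by omega)] at hcoeff
    have h0 : P.coeff 0 = 0 := by simpa using hcoeff.symm
    have := Polynomial.eq_C_of_degree_eq_zero hd
    rw [h0, map_zero] at this
    exact hP0 this
  obtain ⟨α, hα⟩ := IsAlgClosed.exists_root P hdeg
  have hα1 : ‖α‖ ≠ 1 := fun h1 => hroot α h1 hα
  refine ⟨α, ?_⟩
  obtain ⟨Q, hQ⟩ := Polynomial.dvd_iff_isRoot.2 hα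
  have hQ0 : Q ≠ 0 := by rintro rfl; exact hP0 (by simpa using hQ)
  have hQdeg : P.natDegree = 1 + Q.natDegree := by
    rw [hQ, Polynomial.natDegree_mul (Polynomial.X_sub_C_ne_zero α) hQ0,
      Polynomial.natDegree_X_sub_C]
  by_cases hα0 : α = 0
  · subst hα0
    have hlt : P.natDegree ≠ 2 * (n + 1) := by
      intro hd
      have h0 : P.coeff 0 = 0 := by
        rw [Polynomial.coeff_zero_eq_eval_zero]; exact hα
      rw [h0, map_zero, ← hd, Polynomial.coeff_natDegree, Polynomial.leadingCoeff_eq_zero]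
        at hcoeff
      exact hP0 hcoeff
    exact ⟨Q, hα1, by omega, by simpa using hQ⟩
  · have hcα : starRingEnd ℂ α ≠ 0 := by simpa using hα0
    -- The mirror image of `α` in the circle is also a root, distinct from `α` since `‖α‖ ≠ 1`.
    set β : ℂ := (starRingEnd ℂ α)⁻¹ with hβ
    have hβ0 : β ≠ 0 := inv_ne_zero hcα
    have hPβ : P.eval β = 0 := by
      rw [← hrefl, eval_conjReflect hP hβ0, hβ, map_inv₀, Complex.conj_conj, inv_inv,
        Polynomial.IsRoot.def.1 hα]
      simp
    have hβα : β - α ≠ 0 := by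
      intro h0
      apply hα1
      have : α * starRingEnd ℂ α = 1 := by
        nth_rewrite 1 [← sub_eq_zero.1 h0]
        exact inv_mul_cancel₀ hcα
      rw [Complex.mul_conj'] at this
      have h2 : ‖α‖ ^ 2 = 1 := by exact_mod_cast this
      exact (pow_eq_one_iff_of_nonneg (norm_nonneg α) two_ne_zero).1 h2
    have hQβ : Q.IsRoot β := by
      rw [hQ, Polynomial.eval_mul, Polynomial.eval_sub, Polynomial.eval_X, Polynomial.eval_C]
        at hPβ
      exact (mul_eq_zero.1 hPβ).resolve_left hβα
    obtain ⟨P₂, hP₂⟩ := Polynomial.dvd_iff_isRoot.2 hQβ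
    have hP₂0 : P₂ ≠ 0 := by rintro rfl; exact hQ0 (by simpa using hP₂)
    have hdeg₂ : Q.natDegree = 1 + P₂.natDegree := by
      rw [hP₂, Polynomial.natDegree_mul (Polynomial.X_sub_C_ne_zero β) hP₂0,
        Polynomial.natDegree_X_sub_C]
    refine ⟨Polynomial.C (-β) * P₂, hα1,
      (Polynomial.natDegree_C_mul_le _ _).trans (by omega), ?_⟩
    rw [hQ, hP₂]
    have hC : Polynomial.C (starRingEnd ℂ α) * Polynomial.C β = 1 := by
      rw [← map_mul, hβ, mul_inv_cancel₀ hcα, map_one]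
    rw [map_neg]
    linear_combination
      (-(Polynomial.X - Polynomial.C α) * Polynomial.X * P₂) * hC

/-- Fejér–Riesz theorem for strictly positive trigonometric polynomials. -/
theorem fejer_riesz (n : ℕ) : ∀ P : Polynomial ℂ, P.natDegree ≤ 2 * n →
    (∀ z : ℂ, ‖z‖ = 1 → ∃ t : ℝ, 0 < t ∧ P.eval z = t * z ^ n) →
    ∃ H : Polynomial ℂ, H.natDegree ≤ n ∧
      ∀ z : ℂ, ‖z‖ = 1 → P.eval z = ((‖H.eval z‖ ^ 2 : ℝ) : ℂ) * z ^ n := by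
  induction n with
  | zero =>
    intro P hP h
    obtain ⟨t, ht, ht1⟩ := h 1 (by simp)
    have hPC := Polynomial.eq_C_of_natDegree_eq_zero (Nat.le_zero.1 hP)
    refine ⟨Polynomial.C (Real.sqrt t : ℂ), by simp, fun z _ => ?_⟩
    rw [hPC] at ht1 ⊢
    simp only [Polynomial.eval_C, pow_zero, mul_one] at ht1 ⊢
    rw [ht1, Complex.norm_real, Real.norm_eq_abs, sq_abs, Real.sq_sqrt ht.le]
  | succ n ih =>
    intro P hP h
    obtain ⟨α, P₁, hα, hdeg, hfac⟩ := exists_factor_of_pos_on_circle hP h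
    have hev : ∀ z : ℂ, ‖z‖ = 1 →
        -- On the circle `1 - conj α * z = z * conj (z - α)`.
        P.eval z = ((‖z - α‖ ^ 2 : ℝ) : ℂ) * z * P₁.eval z := by
      intro z hz
      have h1 := mul_conj_eq_one_of_norm_eq_one hz
      rw [hfac, Complex.ofReal_pow, ← Complex.mul_conj']
      simp only [Polynomial.eval_mul, Polynomial.eval_sub, Polynomial.eval_X, Polynomial.eval_C,
        Polynomial.eval_one, map_sub]
      linear_combination (-(z - α) * P₁.eval z) * h1
    have hpos : ∀ z : ℂ, ‖z‖ = 1 → 0 < ‖z - α‖ ^ 2 := by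
      intro z hz
      have : z - α ≠ 0 := by
        intro h0
        exact hα (by rw [← sub_eq_zero.1 h0, hz])
      positivity
    obtain ⟨H, hH, hHz⟩ := ih P₁ hdeg fun z hz => by
      obtain ⟨t, ht, htz⟩ := h z hz
      have hz0 : z ≠ 0 := by rintro rfl; simp at hz
      refine ⟨t / ‖z - α‖ ^ 2, div_pos ht (hpos z hz), ?_⟩
      have hne : ((‖z - α‖ ^ 2 : ℝ) : ℂ) ≠ 0 := by exact_mod_cast (hpos z hz).ne'
      rw [hev z hz] at htz
      rw [Complex.ofReal_div]
      refine mul_left_cancel₀ (mul_ne_zero hne hz0) ?_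
      rw [htz, pow_succ]
      field_simp
    refine ⟨H * (Polynomial.X - Polynomial.C α), ?_, fun z hz => ?_⟩
    · refine Polynomial.natDegree_mul_le.trans ?_
      rw [Polynomial.natDegree_X_sub_C]
      omega
    · rw [hev z hz, hHz z hz, Polynomial.eval_mul, norm_mul, mul_pow]
      simp only [Polynomial.eval_sub, Polynomial.eval_X, Polynomial.eval_C]
      push_cast
      ring

/-- On the circle `g z^n` plus the reflection of `g` is `2 z^n Re g = 0`. The two summands overlap
only in degree `n`. -/
theorem coeff_of_re_eq_zero_on_circle {n : ℕ} {g : Polynomial ℂ} (hg : g.natDegree ≤ n)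
    (h : ∀ z : ℂ, ‖z‖ = 1 → (g.eval z).re = 0) :
    (g.coeff 0).re = 0 ∧ ∀ k, 0 < k → g.coeff k = 0 := by
  have hzero : g * Polynomial.X ^ n + conjReflect n g = 0 := by
    refine Polynomial.eq_of_eval_eq_of_norm_eq_one fun z hz => ?_
    rw [Polynomial.eval_add, eval_conjReflect_of_norm_eq_one hg hz]
    simp only [Polynomial.eval_mul, Polynomial.eval_pow, Polynomial.eval_X, Polynomial.eval_zero]
    have := Complex.add_conj (g.eval z)
    rw [h z hz] at this
    push_cast at this
    linear_combination z ^ n * this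
  have hc : ∀ k, g.coeff k + starRingEnd ℂ (g.coeff (Polynomial.revAt n (k + n))) = 0 := by
    intro k
    have := congrArg (fun p => Polynomial.coeff p (k + n)) hzero
    simpa only [Polynomial.coeff_add, Polynomial.coeff_mul_X_pow, coeff_conjReflect,
      Polynomial.coeff_zero] using this
  constructor
  · have := hc 0
    rw [zero_add, Polynomial.revAt_le le_rfl, Nat.sub_self, Complex.add_conj] at this
    have h2 : 2 * (g.coeff 0).re = 0 := by exact_mod_cast this
    linarith
  · intro k hk
    have := hc k
    rwa [Polynomial.revAt_eq_self_of_lt (by omega),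
      Polynomial.coeff_eq_zero_of_natDegree_lt (by omega : g.natDegree < k + n), map_zero,
      add_zero] at this

/-! ### The analytic polynomial whose real part is `|H| ^ 2` -/

/-- The polynomial `∑ h_i conj(h_j) z ^ |i - j|`, with the conjugate coefficient for `i < j`; on
the unit circle its real part is `|∑ h_i z ^ i| ^ 2`. -/
noncomputable def autocorr (n : ℕ) (h : ℕ → ℂ) : Polynomial ℂ :=
  ∑ i ∈ Finset.range (n + 1), ∑ j ∈ Finset.range (n + 1),
    Polynomial.monomial ((i - j) + (j - i))
      (if j ≤ i then h i * starRingEnd ℂ (h j) else h j * starRingEnd ℂ (h i))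

theorem natDegree_autocorr_le (n : ℕ) (h : ℕ → ℂ) : (autocorr n h).natDegree ≤ n := by
  refine Polynomial.natDegree_sum_le_of_forall_le _ _ fun i hi => ?_
  refine Polynomial.natDegree_sum_le_of_forall_le _ _ fun j hj => ?_
  refine (Polynomial.natDegree_monomial_le _).trans ?_
  rw [Finset.mem_range] at hi hj
  omega

theorem coeff_autocorr (n : ℕ) (h : ℕ → ℂ) (k : ℕ) :
    (autocorr n h).coeff k = ∑ i ∈ Finset.range (n + 1), ∑ j ∈ Finset.range (n + 1),
      if (i - j) + (j - i) = k then
        (if j ≤ i then h i * starRingEnd ℂ (h j) else h j * starRingEnd ℂ (h i)) else 0 := by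
  simp only [autocorr, Polynomial.finsetSum_coeff, Polynomial.coeff_monomial]

theorem coeff_zero_autocorr (n : ℕ) (h : ℕ → ℂ) :
    (autocorr n h).coeff 0 = ((∑ i ∈ Finset.range (n + 1), ‖h i‖ ^ 2 : ℝ) : ℂ) := by
  rw [coeff_autocorr, Complex.ofReal_sum]
  refine Finset.sum_congr rfl fun i hi => ?_
  rw [Finset.sum_eq_single i]
  · simp [Complex.mul_conj']
  · intro j _ hj
    rw [if_neg (by omega)]
  · intro hi'
    exact absurd hi hi'

theorem mul_pow_mul_conj_re {z : ℂ} (hz : ‖z‖ = 1) (a b : ℂ) (i j : ℕ) :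
    ((a * z ^ i) * starRingEnd ℂ (b * z ^ j)).re =
      ((if j ≤ i then a * starRingEnd ℂ b else b * starRingEnd ℂ a) *
        z ^ ((i - j) + (j - i))).re := by
  have h1 := mul_conj_eq_one_of_norm_eq_one hz
  have key : ∀ (a b : ℂ) (i j : ℕ), j ≤ i →
      (a * z ^ i) * starRingEnd ℂ (b * z ^ j) = a * starRingEnd ℂ b * z ^ (i - j) := by
    intro a b i j hij
    obtain ⟨d, rfl⟩ := Nat.exists_eq_add_of_le hij
    rw [Nat.add_sub_cancel_left, map_mul, map_pow]
    calc _ = a * starRingEnd ℂ b * z ^ d * (z * starRingEnd ℂ z) ^ j := by ring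
      _ = _ := by rw [h1]; ring
  by_cases hij : j ≤ i
  · rw [key a b i j hij, if_pos hij, Nat.sub_eq_zero_of_le hij, add_zero]
  · have hji : i ≤ j := (not_le.1 hij).le
    rw [if_neg hij, Nat.sub_eq_zero_of_le hji, zero_add, ← key b a j i hji, ← Complex.conj_re,
      map_mul, Complex.conj_conj, mul_comm]

theorem eval_autocorr_re (n : ℕ) (h : ℕ → ℂ) {z : ℂ} (hz : ‖z‖ = 1) :
    ((autocorr n h).eval z).re = ‖∑ i ∈ Finset.range (n + 1), h i * z ^ i‖ ^ 2 := by
  have : ((‖∑ i ∈ Finset.range (n + 1), h i * z ^ i‖ ^ 2 : ℝ) : ℂ) =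
      (∑ i ∈ Finset.range (n + 1), h i * z ^ i) *
        starRingEnd ℂ (∑ i ∈ Finset.range (n + 1), h i * z ^ i) := by
    rw [Complex.mul_conj']; push_cast; rfl
  rw [← Complex.ofReal_re (‖_‖ ^ 2), this, map_sum, Finset.sum_mul_sum, autocorr,
    Polynomial.eval_finsetSum, Complex.re_sum, Complex.re_sum]
  refine Finset.sum_congr rfl fun i _ => ?_
  rw [Polynomial.eval_finsetSum, Complex.re_sum, Complex.re_sum]
  refine Finset.sum_congr rfl fun j _ => ?_
  rw [Polynomial.eval_monomial, mul_pow_mul_conj_re hz]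

/-- Triangle inequality, with the pairs `(i, j)` grouped by `|i - j| = k`. -/
theorem sum_norm_coeff_autocorr_le {r : ℝ} (hr : 0 ≤ r) (n : ℕ) (h : ℕ → ℂ) :
    ∑ k ∈ Finset.range (n + 1), ‖(autocorr n h).coeff k‖ * r ^ k ≤
      ∑ i ∈ Finset.range (n + 1), ∑ j ∈ Finset.range (n + 1), kms r i j * (‖h i‖ * ‖h j‖) := by
  have hk : ∀ k, ‖(autocorr n h).coeff k‖ * r ^ k ≤
      ∑ i ∈ Finset.range (n + 1), ∑ j ∈ Finset.range (n + 1),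
        if (i - j) + (j - i) = k then kms r i j * (‖h i‖ * ‖h j‖) else 0 := by
    intro k
    rw [coeff_autocorr]
    refine (mul_le_mul_of_nonneg_right ((norm_sum_le _ _).trans
      (Finset.sum_le_sum fun i _ => norm_sum_le _ _)) (pow_nonneg hr k)).trans ?_
    simp_rw [Finset.sum_mul]
    refine Finset.sum_le_sum fun i _ => Finset.sum_le_sum fun j _ => ?_
    by_cases hijk : (i - j) + (j - i) = k
    · rw [if_pos hijk, if_pos hijk, kms, hijk]
      split_ifs <;> rw [norm_mul, RCLike.norm_conj] <;> apply le_of_eq <;> ring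
    · rw [if_neg hijk, if_neg hijk, norm_zero, zero_mul]
  refine (Finset.sum_le_sum fun k _ => hk k).trans (le_of_eq ?_)
  rw [Finset.sum_comm]
  refine Finset.sum_congr rfl fun i hi => ?_
  rw [Finset.sum_comm]
  refine Finset.sum_congr rfl fun j hj => ?_
  rw [Finset.sum_ite_eq, if_pos]
  rw [Finset.mem_range] at *
  omega

/-- For real `x` the form is the value of the autocorrelation polynomial at `r`, so no sign
condition on `x` is needed. -/
theorem le_sum_norm_coeff_autocorr {r : ℝ} (hr : 0 ≤ r) (n : ℕ) (x : ℕ → ℝ) :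
    ∑ i ∈ Finset.range (n + 1), ∑ j ∈ Finset.range (n + 1), kms r i j * (x i * x j) ≤
      ∑ k ∈ Finset.range (n + 1), ‖(autocorr n fun i => (x i : ℂ)).coeff k‖ * r ^ k := by
  set q := autocorr n fun i => (x i : ℂ) with hq
  have h1 : (q.eval (r : ℂ)) = ((∑ i ∈ Finset.range (n + 1), ∑ j ∈ Finset.range (n + 1),
      kms r i j * (x i * x j) : ℝ) : ℂ) := by
    simp only [hq, autocorr, Polynomial.eval_finsetSum, Polynomial.eval_monomial,
      Complex.ofReal_sum, kms, Complex.conj_ofReal]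
    refine Finset.sum_congr rfl fun i _ => Finset.sum_congr rfl fun j _ => ?_
    split_ifs <;> push_cast <;> ring
  calc _ = (q.eval (r : ℂ)).re := by rw [h1, Complex.ofReal_re]
    _ ≤ ‖q.eval (r : ℂ)‖ := Complex.re_le_norm _
    _ ≤ _ := by
      rw [Polynomial.eval_eq_sum_range' (Nat.lt_succ_of_le (natDegree_autocorr_le n _))]
      refine (norm_sum_le _ _).trans (le_of_eq (Finset.sum_congr rfl fun k _ => ?_))
      rw [norm_mul, norm_pow, Complex.norm_real, Real.norm_of_nonneg hr]

/-! ### The Bohr inequality and the positivity of the kernel -/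

theorem norm_eval_le_supNorm (p : Polynomial ℂ) {z : ℂ} (hz : ‖z‖ ≤ 1) :
    ‖p.eval z‖ ≤ supNorm p := by
  have hcl : z ∈ closure (Metric.ball (0 : ℂ) 1) := by
    rw [closure_ball _ one_ne_zero]; simpa using hz
  refine closure_minimal (t := {w | ‖p.eval w‖ ≤ supNorm p}) (fun w hw => ?_)
    (isClosed_le p.continuous.norm continuous_const) hcl
  exact le_ciSup (bddAbove_supNorm p) ⟨w, hw⟩

theorem supNorm_le_of_circle {p : Polynomial ℂ} {M : ℝ}
    (h : ∀ z : ℂ, ‖z‖ = 1 → ‖p.eval z‖ ≤ M) : supNorm p ≤ M := by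
  have : Nonempty (Metric.ball (0 : ℂ) 1) := ⟨⟨0, by simp⟩⟩
  refine ciSup_le fun z => ?_
  refine Complex.norm_le_of_forall_mem_frontier_norm_le (f := fun z => p.eval z)
    Metric.isBounded_ball (p.differentiable.diffContOnCl) (fun w hw => ?_)
    (subset_closure z.2)
  rw [frontier_ball _ one_ne_zero] at hw
  exact h w (by simpa using hw)

/-- A strictly positive real part on the circle is the real part of an autocorrelation. -/
theorem exists_autocorr_of_re_lt {n : ℕ} {g : Polynomial ℂ} (hg : g.natDegree ≤ n) {M : ℝ}
    (h : ∀ z : ℂ, ‖z‖ = 1 → (g.eval z).re < M) :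
    ∃ x : ℕ → ℂ, (g.coeff 0).re + ∑ i ∈ Finset.range (n + 1), ‖x i‖ ^ 2 = M ∧
      ∀ k, 0 < k → g.coeff k = -(autocorr n x).coeff k := by
  -- On the circle `P = z^n (M - Re g)`.
  set P : Polynomial ℂ := Polynomial.C (M : ℂ) * Polynomial.X ^ n -
    Polynomial.C (1 / 2) * (Polynomial.X ^ n * g + conjReflect n g) with hPdef
  have hP : P.natDegree ≤ 2 * n := by
    have h1 : (Polynomial.X ^ n * g).natDegree ≤ 2 * n :=
      Polynomial.natDegree_mul_le.trans (by rw [Polynomial.natDegree_X_pow]; omega)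
    have h2 := natDegree_conjReflect_le hg
    refine (Polynomial.natDegree_sub_le _ _).trans (max_le ?_ ?_)
    · exact (Polynomial.natDegree_C_mul_X_pow_le _ _).trans (by omega)
    · exact (Polynomial.natDegree_C_mul_le _ _).trans
        (Polynomial.natDegree_add_le_of_degree_le h1 (by omega))
  have hPz : ∀ z : ℂ, ‖z‖ = 1 → P.eval z = ((M - (g.eval z).re : ℝ) : ℂ) * z ^ n := by
    intro z hz
    simp only [hPdef, Polynomial.eval_sub, Polynomial.eval_mul, Polynomial.eval_add,
      Polynomial.eval_C, Polynomial.eval_pow, Polynomial.eval_X,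
      eval_conjReflect_of_norm_eq_one hg hz]
    have := Complex.add_conj (g.eval z)
    push_cast at this ⊢
    linear_combination (-(1 / 2) * z ^ n) * this
  obtain ⟨H, hH, hHz⟩ := fejer_riesz n P hP fun z hz =>
    ⟨_, sub_pos.2 (h z hz), hPz z hz⟩
  refine ⟨H.coeff, ?_⟩
  have hdeg : (g + autocorr n H.coeff - Polynomial.C (M : ℂ)).natDegree ≤ n :=
    (Polynomial.natDegree_sub_le _ _).trans (max_le
      (Polynomial.natDegree_add_le_of_degree_le hg (natDegree_autocorr_le n _)) (by simp))
  obtain ⟨h0, hk⟩ := coeff_of_re_eq_zero_on_circle hdeg fun z hz => by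
    have hz0 : z ≠ 0 := by rintro rfl; simp at hz
    have h1 := mul_right_cancel₀ (pow_ne_zero n hz0) ((hPz z hz).symm.trans (hHz z hz))
    have h2 : M - (g.eval z).re = ‖H.eval z‖ ^ 2 := by exact_mod_cast h1
    rw [Polynomial.eval_sub, Polynomial.eval_add, Polynomial.eval_C, Complex.sub_re,
      Complex.add_re, Complex.ofReal_re, eval_autocorr_re n _ hz,
      ← Polynomial.eval_eq_sum_range' (Nat.lt_succ_of_le hH), ← h2]
    ring
  constructor
  · rw [Polynomial.coeff_sub, Polynomial.coeff_add, Polynomial.coeff_C_zero, coeff_zero_autocorr,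
      Complex.sub_re, Complex.add_re, Complex.ofReal_re, Complex.ofReal_re] at h0
    linarith
  · intro k hk0
    have := hk k hk0
    rw [Polynomial.coeff_sub, Polynomial.coeff_add, Polynomial.coeff_C, if_neg hk0.ne',
      sub_zero] at this
    exact eq_neg_of_add_eq_zero_left this

/-- If the Kac–Murdock–Szegő matrix is at most twice the identity, the Bohr inequality holds. -/
theorem bohr_inequality_of_kms_form_le {n : ℕ} {r : ℝ} (hr : 0 ≤ r)
    (hK : ∀ x : ℕ → ℝ, ∑ i ∈ Finset.range (n + 1), ∑ j ∈ Finset.range (n + 1),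
      kms r i j * (x i * x j) ≤ 2 * ∑ i ∈ Finset.range (n + 1), x i ^ 2)
    {p : Polynomial ℂ} (hp : p.natDegree ≤ n) :
    ∑ k ∈ Finset.range (n + 1), ‖p.coeff k‖ * r ^ k ≤ supNorm p := by
  obtain ⟨u, hu, hua⟩ : ∃ u : ℂ, ‖u‖ = 1 ∧ u * p.coeff 0 = (‖p.coeff 0‖ : ℂ) := by
    by_cases h0 : p.coeff 0 = 0
    · exact ⟨1, by simp, by simp [h0]⟩
    · have hn0 : ‖p.coeff 0‖ ≠ 0 := norm_ne_zero_iff.2 h0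
      refine ⟨(‖p.coeff 0‖ : ℂ) / p.coeff 0, ?_, div_mul_cancel₀ _ h0⟩
      rw [norm_div, Complex.norm_real, norm_norm, div_self hn0]
  -- The slack `ε` provides the strict positivity needed for Fejér–Riesz.
  refine le_of_forall_pos_le_add fun ε hε => ?_
  obtain ⟨x, hx0, hx⟩ := exists_autocorr_of_re_lt (g := Polynomial.C u * p)
    ((Polynomial.natDegree_C_mul_le _ _).trans hp) (M := supNorm p + ε) fun z hz => by
      refine (Complex.re_le_norm _).trans_lt ?_
      rw [Polynomial.eval_mul, Polynomial.eval_C, norm_mul, hu, one_mul]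
      linarith [norm_eval_le_supNorm p hz.le]
  rw [Polynomial.coeff_C_mul, hua, Complex.ofReal_re] at hx0
  have hcoeff : ∀ k, ‖p.coeff (k + 1)‖ = ‖(autocorr n x).coeff (k + 1)‖ := by
    intro k
    rw [← norm_neg ((autocorr n x).coeff _), ← hx _ k.succ_pos, Polynomial.coeff_C_mul, norm_mul,
      hu, one_mul]
  -- The constant coefficient uses up one of the two copies of `∑ ‖x i‖²`; the other equals `M -
  -- |a_0|`.
  have hle := (sum_norm_coeff_autocorr_le hr n x).trans (hK fun i => ‖x i‖)
  rw [Finset.sum_range_succ', coeff_zero_autocorr, Complex.norm_real,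
    Real.norm_of_nonneg (Finset.sum_nonneg fun i _ => sq_nonneg _), pow_zero, mul_one] at hle
  rw [Finset.sum_range_succ', pow_zero, mul_one]
  simp_rw [hcoeff]
  linarith

/-- If the Kac–Murdock–Szegő matrix is not at most twice the identity, the Bohr inequality fails. -/
theorem exists_supNorm_lt_of_lt_kms_form {n : ℕ} {r : ℝ} (hr : 0 ≤ r) {x : ℕ → ℝ}
    (hx : 2 * ∑ i ∈ Finset.range (n + 1), x i ^ 2 <
      ∑ i ∈ Finset.range (n + 1), ∑ j ∈ Finset.range (n + 1), kms r i j * (x i * x j)) :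
    ∃ p : Polynomial ℂ, p.natDegree ≤ n ∧
      supNorm p < ∑ k ∈ Finset.range (n + 1), ‖p.coeff k‖ * r ^ k := by
  set q := autocorr n fun i => (x i : ℂ) with hq
  set S := ∑ i ∈ Finset.range (n + 1), x i ^ 2 with hS
  set Q := ∑ i ∈ Finset.range (n + 1), ∑ j ∈ Finset.range (n + 1), kms r i j * (x i * x j)
  set B := supNorm q
  have hq0 : q.coeff 0 = (S : ℂ) := by
    rw [hq, coeff_zero_autocorr]
    simp [hS]
  have hQ : Q ≤ ∑ k ∈ Finset.range (n + 1), ‖q.coeff k‖ * r ^ k :=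
    le_sum_norm_coeff_autocorr hr n x
  have hS0 : 0 ≤ S := Finset.sum_nonneg fun i _ => sq_nonneg _
  -- Small enough for the first-order gain `ε (Q - 2 S)` to beat the second-order loss `ε² B² / 2`.
  set ε := (Q - 2 * S) / (B ^ 2 + 1) with hεdef
  have hε : 0 < ε := div_pos (by linarith) (by positivity)
  have hεB : ε * (B ^ 2 + 1) = Q - 2 * S := by rw [hεdef]; field_simp
  refine ⟨1 - Polynomial.C (ε : ℂ) * q, ?_, ?_⟩
  · exact (Polynomial.natDegree_sub_le _ _).trans (max_le (by simp)
      ((Polynomial.natDegree_C_mul_le _ _).trans (natDegree_autocorr_le n _)))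
  have hsup : supNorm (1 - Polynomial.C (ε : ℂ) * q) ≤ 1 + ε ^ 2 * B ^ 2 / 2 := by
    refine supNorm_le_of_circle fun z hz => ?_
    -- Since `Re q ≥ 0` on the circle, `|1 - ε q|² ≤ 1 + ε² B² ≤ (1 + ε² B² / 2)²`.
    refine le_of_sq_le_sq ?_ (by positivity)
    have hre : 0 ≤ (q.eval z).re := by rw [hq, eval_autocorr_re n _ hz]; positivity
    have hB : ‖q.eval z‖ ^ 2 ≤ B ^ 2 :=
      pow_le_pow_left₀ (norm_nonneg _) (norm_eval_le_supNorm q hz.le) 2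
    have hexp : ‖(1 - Polynomial.C (ε : ℂ) * q).eval z‖ ^ 2 =
        1 - 2 * ε * (q.eval z).re + ε ^ 2 * ‖q.eval z‖ ^ 2 := by
      rw [Polynomial.eval_sub, Polynomial.eval_one, Polynomial.eval_mul, Polynomial.eval_C,
        Complex.sq_norm, Complex.sq_norm, Complex.normSq_apply, Complex.normSq_apply]
      simp
      ring
    rw [hexp]
    have h1 : 0 ≤ ε * (q.eval z).re := by positivity
    have h2 : ε ^ 2 * ‖q.eval z‖ ^ 2 ≤ ε ^ 2 * B ^ 2 := by gcongr
    nlinarith [sq_nonneg (ε ^ 2 * B ^ 2)]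
  refine hsup.trans_lt ?_
  have hcoeff : ∀ k, ‖(1 - Polynomial.C (ε : ℂ) * q).coeff (k + 1)‖ = ε * ‖q.coeff (k + 1)‖ := by
    intro k
    rw [Polynomial.coeff_sub, Polynomial.coeff_one, if_neg k.succ_ne_zero, zero_sub, norm_neg,
      Polynomial.coeff_C_mul, norm_mul, Complex.norm_real, Real.norm_of_nonneg hε.le]
  have hcoeff0 : 1 - ε * S ≤ ‖(1 - Polynomial.C (ε : ℂ) * q).coeff 0‖ := by
    refine le_trans (le_of_eq ?_) (Complex.re_le_norm _)
    simp [hq0]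
  rw [Finset.sum_range_succ', hq0, Complex.norm_real, Real.norm_of_nonneg hS0, pow_zero,
    mul_one] at hQ
  rw [Finset.sum_range_succ', pow_zero, mul_one]
  simp_rw [hcoeff, mul_assoc, ← Finset.mul_sum]
  have h3 := mul_le_mul_of_nonneg_left hQ hε.le
  have h4 : ε * (ε * (B ^ 2 + 1)) = ε * (Q - 2 * S) := by rw [hεB]
  nlinarith [sq_nonneg (ε * B), mul_pos hε hε]

/-! ### Bounds for the Bohr radius and its asymptotics -/

theorem le_bohrRadius {n : ℕ} {r : ℝ} (hr0 : 0 < r) (hr1 : r ≤ 1 / 2)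
    (h : 0 ≤ 3 * r ^ 2 - 4 * r * Real.cos (Real.pi / (n + 4)) + 1) : r ≤ bohrRadius n :=
  le_csSup ⟨1, fun _ hs => hs.1.2.le⟩ ⟨⟨hr0, by linarith⟩, fun _ hp =>
    bohr_inequality_of_kms_form_le hr0.le (kms_form_le hr0 hr1 h) hp⟩

theorem bohrRadius_le {n : ℕ} {r : ℝ} (hr0 : 0 < r) (hr1 : r < 1)
    (h : 3 * r ^ 2 - 4 * r * Real.cos (Real.pi / (n + 2)) + 1 < 0) : bohrRadius n ≤ r := by
  refine Real.sSup_le (fun s hs => ?_) hr0.le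
  -- The coefficient sum increases with the radius, so an admissible `s > r` would force the Bohr
  -- inequality at `r`.
  by_contra! hlt
  obtain ⟨x, hx⟩ := lt_kms_form_sin hr0 hr1 h
  obtain ⟨p, hp, hlt'⟩ := exists_supNorm_lt_of_lt_kms_form hr0.le hx
  refine absurd (hs.2 p hp) (not_le.2 (hlt'.trans_le ?_))
  gcongr

/-- Uses `1 - cos x = 2 sin² (x / 2)` and continuity of `sinc` at `0`; the shift `c` disappears in
the limit. -/
theorem tendsto_sq_mul_one_sub_cos_pi_div (c : ℝ) (hc : 0 < c) :
    Tendsto (fun n : ℕ => (n : ℝ) ^ 2 * (1 - Real.cos (Real.pi / (n + c)))) atTop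
      (𝓝 (Real.pi ^ 2 / 2)) := by
  have hinv : Tendsto (fun n : ℕ => ((n : ℝ) + c)⁻¹) atTop (𝓝 0) :=
    tendsto_inv_atTop_zero.comp (tendsto_atTop_add_const_right _ c tendsto_natCast_atTop_atTop)
  have hy : Tendsto (fun n : ℕ => Real.pi / 2 * ((n : ℝ) + c)⁻¹) atTop (𝓝 0) := by
    simpa using hinv.const_mul (Real.pi / 2)
  have hsinc : Tendsto (fun n : ℕ => Real.sinc (Real.pi / 2 * ((n : ℝ) + c)⁻¹)) atTop (𝓝 1) := by
    rw [← Real.sinc_zero]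
    exact (Real.continuous_sinc.tendsto 0).comp hy
  have hratio : Tendsto (fun n : ℕ => 1 - c * ((n : ℝ) + c)⁻¹) atTop (𝓝 1) := by
    simpa using (hinv.const_mul c).const_sub 1
  have hlim := (((hratio.const_mul (Real.pi / 2)).mul hsinc).pow 2).const_mul 2
  have h1 : 2 * (Real.pi / 2 * 1 * 1) ^ 2 = Real.pi ^ 2 / 2 := by ring
  rw [h1] at hlim
  refine hlim.congr fun n => ?_
  have hn : (0 : ℝ) < n + c := by positivity
  have hne : Real.pi / 2 * ((n : ℝ) + c)⁻¹ ≠ 0 := by positivity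
  rw [Real.sinc_of_ne_zero hne]
  have h2 : Real.pi / (n + c) = 2 * (Real.pi / 2 * ((n : ℝ) + c)⁻¹) := by field_simp
  rw [h2, Real.cos_two_mul, Real.cos_sq']
  field_simp
  ring

theorem tendsto_add_div_sq (a : ℝ) :
    Tendsto (fun n : ℕ => 1 / 3 + a / (n : ℝ) ^ 2) atTop (𝓝 (1 / 3)) := by
  have h : Tendsto (fun n : ℕ => a / (n : ℝ) ^ 2) atTop (𝓝 0) :=
    tendsto_const_nhds.div_atTop
      ((tendsto_pow_atTop two_ne_zero).comp tendsto_natCast_atTop_atTop)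
  simpa only [add_zero] using h.const_add (1 / 3 : ℝ)

/-- Write the quadratic as `(3 r - 1)(r - 1) + 4 r (1 - cos)`, where `3 r - 1 = 3 a / n²`. The sign
of the limit decides on which side of `bohrRadius n` the trial radius eventually falls. -/
theorem tendsto_sq_mul_quadratic (a c : ℝ) (hc : 0 < c) :
    Tendsto (fun n : ℕ => (n : ℝ) ^ 2 * (3 * (1 / 3 + a / (n : ℝ) ^ 2) ^ 2 -
      4 * (1 / 3 + a / (n : ℝ) ^ 2) * Real.cos (Real.pi / (n + c)) + 1)) atTop
      (𝓝 (2 * (Real.pi ^ 2 / 3 - a))) := by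
  have hr := tendsto_add_div_sq a
  have hlim := ((hr.sub_const 1).const_mul (3 * a)).add
    ((hr.const_mul 4).mul (tendsto_sq_mul_one_sub_cos_pi_div c hc))
  have h1 : 3 * a * (1 / 3 - 1) + 4 * (1 / 3) * (Real.pi ^ 2 / 2) =
    2 * (Real.pi ^ 2 / 3 - a) := by ring
  rw [h1] at hlim
  refine hlim.congr' ?_
  filter_upwards [eventually_gt_atTop 0] with n hn
  have hn' : (n : ℝ) ≠ 0 := by positivity
  field_simp
  ring

theorem tendsto_sq_mul_bohrRadius_sub :
    Tendsto (fun n : ℕ => (n : ℝ) ^ 2 * (bohrRadius n - 1 / 3)) atTop (𝓝 (Real.pi ^ 2 / 3)) := by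
  have hcancel : ∀ (a : ℝ) (n : ℕ), 0 < n → (n : ℝ) ^ 2 * (1 / 3 + a / (n : ℝ) ^ 2 - 1 / 3) = a := by
    intro a n hn
    have hn' : (n : ℝ) ≠ 0 := by positivity
    field_simp
    ring
  refine tendsto_order.2 ⟨fun b hb => ?_, fun b hb => ?_⟩
  · obtain ⟨a, hba, ha⟩ := exists_between hb
    have hq := (tendsto_sq_mul_quadratic a 4 (by norm_num)).eventually_const_lt
      (by linarith : (0 : ℝ) < 2 * (Real.pi ^ 2 / 3 - a))
    filter_upwards [hq, eventually_gt_atTop 0,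
      (tendsto_add_div_sq a).eventually_const_lt (by norm_num : (0 : ℝ) < 1 / 3),
      (tendsto_add_div_sq a).eventually_lt_const (by norm_num : (1 / 3 : ℝ) < 1 / 2)]
      with n hn hn0 hr0 hr1
    have hle := le_bohrRadius hr0 hr1.le (pos_of_mul_pos_right hn (sq_nonneg _)).le
    calc b < a := hba
      _ = (n : ℝ) ^ 2 * (1 / 3 + a / (n : ℝ) ^ 2 - 1 / 3) := (hcancel a n hn0).symm
      _ ≤ _ := by gcongr
  · obtain ⟨a, ha, hab⟩ := exists_between hb
    have hq := (tendsto_sq_mul_quadratic a 2 (by norm_num)).eventually_lt_const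
      (by linarith : 2 * (Real.pi ^ 2 / 3 - a) < (0 : ℝ))
    filter_upwards [hq, eventually_gt_atTop 0,
      (tendsto_add_div_sq a).eventually_const_lt (by norm_num : (0 : ℝ) < 1 / 3),
      (tendsto_add_div_sq a).eventually_lt_const (by norm_num : (1 / 3 : ℝ) < 1)]
      with n hn hn0 hr0 hr1
    have hle := bohrRadius_le hr0 hr1 (neg_of_mul_neg_right hn (sq_nonneg _))
    calc _ ≤ (n : ℝ) ^ 2 * (1 / 3 + a / (n : ℝ) ^ 2 - 1 / 3) := by gcongr
      _ = a := hcancel a n hn0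
      _ < b := hab

theorem theorem2 :
    Tendsto (fun n : ℕ => (n : ℝ) ^ 2 * (bohrRadius n - 1 / 3)) atTop (𝓝 (Real.pi ^ 2 / 3)) ∧
    (fun n : ℕ => bohrRadius n - (1 / 3 + Real.pi ^ 2 / (3 * (n : ℝ) ^ 2)))
      =o[atTop] (fun n : ℕ => 1 / (n : ℝ) ^ 2) := by
  refine ⟨tendsto_sq_mul_bohrRadius_sub, ?_⟩
  refine (isLittleO_iff_tendsto' ?_).2 ?_
  · filter_upwards [eventually_gt_atTop 0] with n hn h
    have hn' : (n : ℝ) ≠ 0 := by positivity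
    simp [hn'] at h
  · have h := tendsto_sq_mul_bohrRadius_sub.sub_const (Real.pi ^ 2 / 3)
    rw [sub_self] at h
    refine h.congr' ?_
    filter_upwards [eventually_gt_atTop 0] with n hn
    have hn' : (n : ℝ) ≠ 0 := by positivity
    field_simp
    ring
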